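/- A virtual knot diagram is an oriented circle generically immersed in the plane whose finitely many transverse double points are classical crossings (with over/under information) or virtual crossings. A welded knot is an equivalence class of virtual knot diagrams under planar isotopy and the welded Reidemeister moves: the classical moves R1, R2, R3; the virtual moves VR1, VR2, VR3 (the same moves with all crossings virtual) and VR4 (a strand is moved across a classical crossing, its crossings with both other strands being virtual); and the move OC (a strand is moved over a virtual crossing, passing over both other strands). For a positive integer $n$, the $V^n$-move is the local move that replaces two parallel, equally oriented, crossing-free strands in a disk by two strands that cross $2n$ times, alternately at a classical and a virtual crossing, where the same strand is the over-strand at all $n$ classical crossings. Two welded knots are $V^n$-equivalent if they have diagrams that are related by a finite sequence of $V^n$-moves, their inverses, and welded Reidemeister moves. The $V^n$-move is an unknotting operation on welded knots if every welded knot is $V^n$-equivalent to the unknot. **Proposition.** Let $n\ge 2$. Then the trefoil knot (of either handedness) is not $V^n$-equivalent to the unknot. Hence the $V^n$-move is not an unknotting operation on welded knots. -/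

import Mathlib

/-!
# Welded knots and the moves `V^n`

A one-component virtual link diagram is a generic closed oriented curve in the plane whose double
points are classical or virtual crossings.  We record it by the cyclic word that lists *all* its
double points, virtual ones included, in the order in which the curve runs through them.  Each
passage remembers the name of the double point, whether it is an over-passage, an under-passage or a
virtual passage, and from which side the other branch comes.  This is a complete description of the
diagram up to isotopy; conversely such a word is the word of a planar diagram exactly when the
surface obtained from the 4-valent graph by glueing a disk to every face is a sphere, i.e. when
Euler's formula holds.

All moves (welded Reidemeister moves and `V^n`) replace a tangle without closed components by
another tangle that connects the same end points, so they preserve the number of components; hence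
sequences of moves starting at a knot diagram run through knot diagrams only.
-/

namespace Welded

/-- The three ways in which a curve can run through a double point. -/
inductive Level
  | over
  | under
  | virt
  deriving DecidableEq

/-- The kind of passage of the other branch of the same double point. -/
def Level.opp : Level → Level
  | .over => .under
  | .under => .over
  | .virt => .virt

/-- One passage of the curve through a double point.  `side = 1` means that the other branch crosses
from right to left (so that the directions of this branch and the other branch form a positive
frame of the plane), `side = -1` that it crosses from left to right.  The sign of a classical
crossing is the `side` of its over-passage. -/
structure Passage where
  name : ℕ
  level : Level
  side : ℤˣ
  deriving DecidableEq

/-- The `i`-th and `j`-th letter of `w` are the two passages through one double point. -/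
def Paired (w : List Passage) (i j : Fin w.length) : Prop :=
  i ≠ j ∧ (w.get j).name = (w.get i).name

instance (w : List Passage) (i j : Fin w.length) : Decidable (Paired w i j) :=
  inferInstanceAs (Decidable (_ ∧ _))

/-- Every name that occurs in `w` occurs exactly twice, and the two passages fit together. -/
structure WellFormed (w : List Passage) : Prop where
  existsUnique_paired : ∀ i, ∃! j, Paired w i j
  level_eq : ∀ i j, Paired w i j → (w.get j).level = (w.get i).level.opp
  side_eq : ∀ i j, Paired w i j → (w.get j).side = -(w.get i).side

/-- Walking along the boundary of a face, with the face on the left.  The pair `(i, 1)` stands for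
arriving at the `i`-th passage in the direction of the curve, `(i, -1)` for arriving there against
that direction.  At the double point one turns left into the other branch; one then runs along it in
its direction iff that direction points to the left, and arrives at its next, respectively its
previous, passage in the cyclic order. -/
def FaceStep (w : List Passage) (x y : Fin w.length × ℤˣ) : Prop :=
  ∃ j, Paired w x.1 j ∧
    y = if x.2 * (w.get x.1).side = 1 then (finRotate w.length j, 1)
      else ((finRotate w.length).symm j, -1)

instance (w : List Passage) (x y : Fin w.length × ℤˣ) : Decidable (FaceStep w x y) :=
  inferInstanceAs (Decidable (∃ _, _ ∧ _))

/-- Euler's formula.  With `2 * N = w.length` there are `N` vertices, `2 * N` edges, and the faces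
are the orbits of `FaceStep`; planarity means that there are `N + 2` faces.  The word without letters
is the simple closed curve. -/
def Planar (w : List Passage) : Prop :=
  w ≠ [] → 2 * Nat.card (Quot (FaceStep w)) = w.length + 4

/-- A virtual knot diagram (read from some base point, with names for its double points). -/
structure Diagram where
  word : List Passage
  wellFormed : WellFormed word
  planar : Planar word

/-- Two words describe the same diagram up to isotopy if they differ by the choice of the base point
and of the names of the double points. -/
def SameDiagram (D E : Diagram) : Prop :=
  ∃ (f : Equiv.Perm ℕ) (m : ℕ),
    E.word = (D.word.map fun p => ⟨f p.name, p.level, p.side⟩).rotate m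

/-- `E` is obtained from `D` by replacing the strands `S 0, …, S (k - 1)` of a tangle by
`T 0, …, T (k - 1)`.  The curve may run through the strands in any order `π`, and `u` lists the parts
of the curve outside the tangle.  Since both `D` and `E` are planar, the replacement takes place
in a disk. -/
def Replace {k : ℕ} (S T : Fin k → List Passage) (D E : Diagram) : Prop :=
  ∃ (π : Equiv.Perm (Fin k)) (u : Fin k → List Passage),
    D.word = (List.ofFn fun i => S (π i) ++ u i).flatten ∧
    E.word = (List.ofFn fun i => T (π i) ++ u i).flatten

/-- The list `[x, y]` or `[y, x]`, according to the sign. -/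
def ordered (e : ℤˣ) (x y : Passage) : List Passage :=
  if e = 1 then [x, y] else [y, x]

/-- Three strands in general position in a disk, any two of which meet exactly once.  Strands `0`
and `1` meet in `a`, strands `0` and `2` in `b`, strands `1` and `2` in `c`; the levels `la`,
`lb`, `lc` are those of the strand with the smaller number, and so are the sides `α`, `β`, `γ`.
For given sides there are exactly two such arrangements, distinguished by `δ`: they have the opposite
triangular faces, and the order of the double points is opposite on every strand. -/
def triangle (la lb lc : Level) (a b c : ℕ) (α β γ δ : ℤˣ) : Fin 3 → List Passage :=
  ![ordered (δ * γ) ⟨a, la, α⟩ ⟨b, lb, β⟩,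
    ordered (δ * β) ⟨a, la.opp, -α⟩ ⟨c, lc, γ⟩,
    ordered (δ * α) ⟨b, lb.opp, -β⟩ ⟨c, lc.opp, -γ⟩]

/-- The welded Reidemeister moves: `WeldedMove S T` says that the strands `S` of a tangle may be
replaced by the strands `T` (or vice versa).  All orientations of the strands and all signs occur. -/
inductive WeldedMove : {k : ℕ} → (Fin k → List Passage) → (Fin k → List Passage) → Prop
  /-- A kink with a classical crossing. -/
  | R1 (a : ℕ) (l : Level) (hl : l ≠ .virt) (e : ℤˣ) :
      WeldedMove ![[]] ![[⟨a, l, e⟩, ⟨a, l.opp, -e⟩]]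
  /-- A kink with a virtual crossing. -/
  | VR1 (a : ℕ) (e : ℤˣ) :
      WeldedMove ![[]] ![[⟨a, .virt, e⟩, ⟨a, .virt, -e⟩]]
  /-- One strand is pushed over another one, both in the same direction. -/
  | R2_parallel (a b : ℕ) (e : ℤˣ) :
      WeldedMove ![[], []]
        ![[⟨a, .over, e⟩, ⟨b, .over, -e⟩], [⟨a, .under, -e⟩, ⟨b, .under, e⟩]]
  /-- One strand is pushed over another one, in opposite directions. -/
  | R2_antiparallel (a b : ℕ) (e : ℤˣ) :
      WeldedMove ![[], []]
        ![[⟨a, .over, e⟩, ⟨b, .over, -e⟩], [⟨b, .under, e⟩, ⟨a, .under, -e⟩]]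
  | VR2_parallel (a b : ℕ) (e : ℤˣ) :
      WeldedMove ![[], []]
        ![[⟨a, .virt, e⟩, ⟨b, .virt, -e⟩], [⟨a, .virt, -e⟩, ⟨b, .virt, e⟩]]
  | VR2_antiparallel (a b : ℕ) (e : ℤˣ) :
      WeldedMove ![[], []]
        ![[⟨a, .virt, e⟩, ⟨b, .virt, -e⟩], [⟨b, .virt, e⟩, ⟨a, .virt, -e⟩]]
  /-- Three classical crossings; strand `0` is the top strand and strand `2` the bottom strand. -/
  | R3 (a b c : ℕ) (α β γ : ℤˣ) :
      WeldedMove (triangle .over .over .over a b c α β γ 1)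
        (triangle .over .over .over a b c α β γ (-1))
  /-- Three virtual crossings. -/
  | VR3 (a b c : ℕ) (α β γ : ℤˣ) :
      WeldedMove (triangle .virt .virt .virt a b c α β γ 1)
        (triangle .virt .virt .virt a b c α β γ (-1))
  /-- Strand `0` is moved virtually across a classical crossing. -/
  | VR4 (a b c : ℕ) (α β γ : ℤˣ) :
      WeldedMove (triangle .virt .virt .over a b c α β γ 1)
        (triangle .virt .virt .over a b c α β γ (-1))
  /-- Over-crossings commute: strand `0` is moved over a virtual crossing. -/
  | OC (a b c : ℕ) (α β γ : ℤˣ) :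
      WeldedMove (triangle .over .over .virt a b c α β γ 1)
        (triangle .over .over .virt a b c α β γ (-1))

/-- The move `V^n` on two parallel strands: strand `0` passes over strand `1` at a classical crossing
`c i` and the strands then change their places back at a virtual crossing `v i`; this is repeated
`n` times, all classical crossings having the same sign `e`.  (Once the over-strand is chosen among
two given parallel strands, `e` is determined by the side on which it lies.  The move of one sign
follows from that of the other sign and moves R2 and VR2, so that allowing both does not change the
equivalence relation.) -/
inductive VMove (n : ℕ) : {k : ℕ} → (Fin k → List Passage) → (Fin k → List Passage) → Prop
  | mk (c v : ℕ → ℕ) (e : ℤˣ) :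
      VMove n ![[], []]
        ![(List.range n).flatMap fun i => [⟨c i, .over, e⟩, ⟨v i, .virt, -e⟩],
          (List.range n).flatMap fun i => [⟨c i, .under, -e⟩, ⟨v i, .virt, e⟩]]

/-- One step of a welded isotopy. -/
def WeldedStep (D E : Diagram) : Prop :=
  SameDiagram D E ∨
    ∃ (k : ℕ) (S T : Fin k → List Passage), WeldedMove S T ∧ Replace S T D E

/-- One application of a `V^n`-move. -/
def VStep (n : ℕ) (D E : Diagram) : Prop :=
  ∃ (k : ℕ) (S T : Fin k → List Passage), VMove n S T ∧ Replace S T D E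

/-- Welded isotopy of virtual knot diagrams. -/
def weldedIsotopy : Setoid Diagram := Relation.EqvGen.setoid WeldedStep

/-- A welded knot is a virtual knot diagram up to welded isotopy. -/
def WeldedKnot : Type := Quotient weldedIsotopy

/-- The welded knot of a diagram. -/
def Diagram.knot (D : Diagram) : WeldedKnot := Quotient.mk weldedIsotopy D

/-- `V^n`-equivalence of welded knots: they have diagrams that are related by a finite sequence of
`V^n`-moves, their inverses, and welded Reidemeister moves. -/
def VEquivalent (n : ℕ) (K L : WeldedKnot) : Prop :=
  ∃ D E : Diagram, D.knot = K ∧ E.knot = L ∧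
    Relation.EqvGen (fun D E => WeldedStep D E ∨ VStep n D E) D E

/-- The diagram without crossings. -/
def unknotDiagram : Diagram where
  word := []
  wellFormed := ⟨fun i => i.elim0, fun i => i.elim0, fun i => i.elim0⟩
  planar := fun h => absurd rfl h

/-- The word of the standard three-crossing diagram of the trefoil: alternating, all crossings of
sign `e`. -/
def trefoilWord (e : ℤˣ) : List Passage :=
  [⟨0, .over, e⟩, ⟨1, .under, -e⟩, ⟨2, .over, e⟩, ⟨0, .under, -e⟩, ⟨1, .over, e⟩, ⟨2, .under, -e⟩]

theorem trefoilWord_wellFormed (e : ℤˣ) : WellFormed (trefoilWord e) := by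
  constructor
  · revert e
    unfold ExistsUnique
    decide
  · revert e
    decide
  · revert e
    decide

/-- The number of the face to the left of a given dart of the trefoil diagram. -/
def trefoilFace (e : ℤˣ) (x : Fin (trefoilWord e).length × ℤˣ) : Fin 5 :=
  if e = 1 then (if x.2 = 1 then ![0, 2, 0, 4, 0, 3] else ![1, 3, 1, 2, 1, 4]) (Fin.cast rfl x.1)
  else (if x.2 = 1 then ![0, 2, 4, 2, 1, 2] else ![1, 3, 0, 3, 4, 3]) (Fin.cast rfl x.1)

set_option maxRecDepth 10000 in
theorem trefoilWord_faces (e : ℤˣ) :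
    2 * Nat.card (Quot (FaceStep (trefoilWord e))) = (trefoilWord e).length + 4 := by
  have h1 : ∀ (e : ℤˣ) (x y : Fin (trefoilWord e).length × ℤˣ),
      FaceStep (trefoilWord e) x y → trefoilFace e x = trefoilFace e y := by
    decide
  have h2 : ∀ (e : ℤˣ) (x y : Fin (trefoilWord e).length × ℤˣ),
      trefoilFace e x = trefoilFace e y →
        x = y ∨ FaceStep (trefoilWord e) x y ∨ FaceStep (trefoilWord e) y x := by
    decide
  have h3 : ∀ (e : ℤˣ) (k : Fin 5), ∃ x, trefoilFace e x = k := by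
    decide
  have hb : Function.Bijective (Quot.lift (trefoilFace e) (h1 e)) := by
    constructor
    · rintro ⟨x⟩ ⟨y⟩ h
      rcases h2 e x y h with h | h | h
      · rw [h]
      · exact Quot.sound h
      · exact (Quot.sound h).symm
    · intro k
      obtain ⟨x, hx⟩ := h3 e k
      exact ⟨Quot.mk _ x, hx⟩
  rw [Nat.card_eq_of_bijective _ hb, Nat.card_fin]
  rfl

/-- The standard diagram of the trefoil with crossings of sign `e`. -/
def trefoilDiagram (e : ℤˣ) : Diagram where
  word := trefoilWord e
  wellFormed := trefoilWord_wellFormed e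
  planar := fun _ => trefoilWord_faces e

/-- The trivial knot. -/
def unknot : WeldedKnot := unknotDiagram.knot

/-- The trefoil knot: right-handed for `e = 1`, left-handed for `e = -1`. -/
def trefoil (e : ℤˣ) : WeldedKnot := (trefoilDiagram e).knot

/-- The `V^n`-move is an unknotting operation on welded knots: every welded knot is turned into the
trivial knot by `V^n`-moves and welded Reidemeister moves. -/
def VUnknotting (n : ℕ) : Prop := ∀ K : WeldedKnot, VEquivalent n K unknot

end Welded

/-! The invariant is the existence of a non-constant Wirtinger colouring in a group `G` by elements
`x` with `x ^ n = 1`: the colour changes only at under-passages, where it is conjugated by the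
over-colour to the power ±1. Virtual crossings have no effect, and neither has the order of
over-passages on a strand, so the moves VR1–VR4 and OC leave colourings alone; R1, R2 and R3 are the
usual Wirtinger (quandle) argument. In a `V^n`-move the under-strand is conjugated `n` times by the
same `g ^ ±1`, and `g ^ n = 1` makes this trivial.

A move is therefore handled by three local facts: the names in the tangle do not occur outside it
(`NamesRepeated`), colourings transfer with the same colours at the ends (`TransfersTo`), and equal
starting colours force a constant colouring of the tangle (`Rigid`), so that non-constancy survives.
`Replace.colorable` combines them.

The crossingless diagram has only constant colourings. A non-constant colouring of the trefoil is a
pair `a ≠ b` with `a * b * a = b * a * b`; the reduced Burau matrices at a primitive `n`-th root of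
unity provide one with `a ^ n = 1`. -/

namespace Welded

/-! ### Colourings along words -/

section Coloring

variable {G : Type*} [Group G]

/-- The effect on the colour `x` of the curve of a passage, where `g` is the colour of the over-branch:
at an under-passage the colour is conjugated by `g ^ side`. -/
def Passage.act (p : Passage) (g x : G) : G :=
  if p.level = .under then g ^ (p.side : ℤ) * x * (g ^ (p.side : ℤ))⁻¹ else x

/-- `Run c w x y`: walking along `w` with initial colour `x` one ends with the colour `y`, where `c`
gives the colours of the over-branches of the classical crossings. -/
def Run (c : ℕ → G) : List Passage → G → G → Prop
  | [], x, y => x = y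
  | p :: w, x, y => (p.level = .over → c p.name = x) ∧ Run c w (p.act (c p.name) x) y

/-- At all classical crossings of `w` the over-branch has colour `g`. -/
def Monochromatic (c : ℕ → G) (w : List Passage) (g : G) : Prop :=
  ∀ p ∈ w, p.level ≠ .virt → c p.name = g

theorem run_append {c : ℕ → G} {v w : List Passage} {x z : G} :
    Run c (v ++ w) x z ↔ ∃ y, Run c v x y ∧ Run c w y z := by
  induction v generalizing x with
  | nil => simp [Run]
  | cons p v ih => simp [Run, ih, and_assoc]

theorem run_congr {c d : ℕ → G} {w : List Passage} (h : ∀ p ∈ w, c p.name = d p.name) {x y : G} :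
    Run c w x y ↔ Run d w x y := by
  induction w generalizing x with
  | nil => simp [Run]
  | cons p w ih =>
    simp only [List.mem_cons, forall_eq_or_imp] at h
    simp [Run, ih h.2, h.1]

theorem run_map {c : ℕ → G} {f : ℕ → ℕ} {w : List Passage} {x y : G} :
    Run c (w.map fun p => ⟨f p.name, p.level, p.side⟩) x y ↔ Run (c ∘ f) w x y := by
  induction w generalizing x with
  | nil => simp [Run]
  | cons p w ih => simp [Run, ih, Passage.act]

/-- Colours along a walk are conjugate, so it is enough to impose the order condition at the base
point. -/
theorem Run.pow_eq_one {c : ℕ → G} {w : List Passage} {x y : G} (h : Run c w x y) {n : ℕ}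
    (hx : x ^ n = 1) : y ^ n = 1 := by
  induction w generalizing x with
  | nil => exact h ▸ hx
  | cons p w ih =>
    refine ih h.2 ?_
    unfold Passage.act
    split_ifs
    · rw [conj_pow, hx]; simp
    · exact hx

theorem Run.eq_of_monochromatic {c : ℕ → G} {w : List Passage} {x y : G} (h : Run c w x y)
    (hw : Monochromatic c w x) : y = x := by
  induction w generalizing x with
  | nil => exact h.symm
  | cons p w ih =>
    have hp : p.act (c p.name) x = x := by
      unfold Passage.act
      split_ifs with hl
      · rw [hw p (by simp) (by simp [hl])]
        have := (Commute.refl x).zpow_left (p.side : ℤ)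
        rw [this.eq]; simp
      · rfl
    have h2 := h.2
    rw [hp] at h2
    exact ih h2 fun q hq => hw q (List.mem_cons_of_mem _ hq)

theorem run_flatten {c : ℕ → G} {k : ℕ} {L : Fin k → List Passage} {x y : G} :
    Run c (List.ofFn L).flatten x y ↔ ∃ s : Fin (k + 1) → G, s 0 = x ∧ s (Fin.last k) = y ∧
      ∀ i, Run c (L i) (s i.castSucc) (s i.succ) := by
  induction k generalizing x with
  | zero =>
    constructor
    · intro h
      exact ⟨fun _ => x, rfl, by simpa [Run] using h, fun i => i.elim0⟩
    · rintro ⟨s, rfl, rfl, -⟩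
      simp [Run]
  | succ k ih =>
    rw [List.ofFn_succ, List.flatten_cons, run_append]
    constructor
    · rintro ⟨z, hz, h⟩
      obtain ⟨s, h0, h1, h2⟩ := ih.1 h
      refine ⟨Fin.cons x s, rfl, by rw [← Fin.succ_last, Fin.cons_succ, h1], ?_⟩
      refine Fin.cases ?_ fun i => ?_
      · simpa [h0] using hz
      · rw [← Fin.succ_castSucc, Fin.cons_succ, Fin.cons_succ]
        exact h2 i
    · rintro ⟨s, rfl, rfl, h⟩
      refine ⟨s 1, h 0, ih.2 ⟨Fin.tail s, rfl, rfl, fun i => ?_⟩⟩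
      exact h i.succ

/-- Here `s` and `t` record the colours where the curve enters and leaves each tangle strand. -/
theorem run_flatten_append {c : ℕ → G} {k : ℕ} {A B : Fin k → List Passage} {x y : G} :
    Run c (List.ofFn fun i => A i ++ B i).flatten x y ↔
      ∃ (s : Fin (k + 1) → G) (t : Fin k → G), s 0 = x ∧ s (Fin.last k) = y ∧
        ∀ i, Run c (A i) (s i.castSucc) (t i) ∧ Run c (B i) (t i) (s i.succ) := by
  simp only [run_flatten, run_append]
  constructor
  · rintro ⟨s, h0, h1, h⟩
    choose t ht using h
    exact ⟨s, t, h0, h1, ht⟩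
  · rintro ⟨s, t, h0, h1, h⟩
    exact ⟨s, h0, h1, fun i => ⟨t i, h i⟩⟩

/-! ### The invariant and tangle replacement -/

/-- The diagram `D` has a non-constant colouring by elements of `G` whose order divides `n`. -/
def Colorable (G : Type*) [Group G] (n : ℕ) (D : Diagram) : Prop :=
  ∃ (c : ℕ → G) (g : G), g ^ n = 1 ∧ Run c D.word g g ∧ ¬ Monochromatic c D.word g

theorem SameDiagram.colorable {n : ℕ} {D E : Diagram} (h : SameDiagram D E) :
    Colorable G n D ↔ Colorable G n E := by
  obtain ⟨f, m, hE⟩ := h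
  -- Rotation of a word: the initial colour is replaced by the colour at the new base point.
  have key : ∀ (v w : List Passage) (c : ℕ → G) (g : G), g ^ n = 1 → Run c (v ++ w) g g →
      ¬ Monochromatic c (v ++ w) g →
      ∃ g', g' ^ n = 1 ∧ Run c (w ++ v) g' g' ∧ ¬ Monochromatic c (w ++ v) g' := by
    intro v w c g hg h hn
    obtain ⟨x, h1, h2⟩ := run_append.1 h
    refine ⟨x, h1.pow_eq_one hg, run_append.2 ⟨g, h2, h1⟩, fun hm => hn ?_⟩
    -- A walk from `x` that meets only over-colours `x` keeps its colour, so both base points carry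
    -- the same one.
    have : g = x := h2.eq_of_monochromatic fun p hp => hm p (List.mem_append_left _ hp)
    rw [this]
    intro p hp
    exact hm p (by simpa [or_comm] using hp)
  have hmap : ∀ c : ℕ → G, ∀ g, Monochromatic c
      (D.word.map fun p => ⟨f p.name, p.level, p.side⟩) g ↔ Monochromatic (c ∘ f) D.word g := by
    intro c g
    simp [Monochromatic]
  rw [List.rotate_eq_drop_append_take_mod] at hE
  unfold Colorable
  rw [hE]
  constructor
  · rintro ⟨c, g, hg, h, hn⟩
    have hc : (c ∘ f.symm) ∘ f = c := by ext; simp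
    refine ⟨c ∘ f.symm, key _ _ _ g hg ?_ ?_⟩
    · rwa [List.take_append_drop, run_map, hc]
    · rwa [List.take_append_drop, hmap, hc]
  · rintro ⟨c, g, hg, h, hn⟩
    obtain ⟨g', hg', h', hn'⟩ := key _ _ c g hg h hn
    rw [List.take_append_drop] at h' hn'
    exact ⟨c ∘ f, g', hg', run_map.1 h', fun hm => hn' ((hmap c g').2 hm)⟩

/-- Every name that occurs in the tangle occurs there at least twice. -/
def NamesRepeated {k : ℕ} (S : Fin k → List Passage) : Prop :=
  ∀ i, ∀ p ∈ S i, 2 ≤ ∑ j, ((S j).map Passage.name).count p.name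

/-- Colourings of the tangle `S` can be changed into colourings of the tangle `T` with the same
colours at the ends. -/
def TransfersTo (G : Type*) [Group G] (n : ℕ) {k : ℕ} (S T : Fin k → List Passage) : Prop :=
  ∀ (c : ℕ → G) (x y : Fin k → G), (∀ i, x i ^ n = 1) → (∀ i, Run c (S i) (x i) (y i)) →
    ∃ d : ℕ → G, (∀ a, (∀ i, ∀ p ∈ T i, p.name ≠ a) → d a = c a) ∧
      ∀ i, Run d (T i) (x i) (y i)

/-- A colouring of the tangle is constant if all strands start with the same colour. -/
def Rigid (G : Type*) [Group G] {k : ℕ} (S : Fin k → List Passage) : Prop :=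
  ∀ (c : ℕ → G) (g : G) (y : Fin k → G), (∀ i, Run c (S i) g (y i)) → ∀ i, Monochromatic c (S i) g

/-- With three occurrences, the first would have two different partners. -/
theorem WellFormed.count_name_le_two {w : List Passage} (hw : WellFormed w) (a : ℕ) :
    (w.map Passage.name).count a ≤ 2 := by
  by_contra! h
  have h3 : (List.replicate 3 a).Sublist (w.map Passage.name) := List.replicate_sublist_iff.2 h
  obtain ⟨l, hl, hm⟩ := List.sublist_map_iff.1 h3
  obtain ⟨f, hf⟩ := List.sublist_iff_exists_fin_orderEmbedding_get_eq.1 hl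
  have hlen : l.length = 3 := by simpa using (congrArg List.length hm).symm
  have hname : ∀ i, (w.get (f i)).name = a := by
    intro i
    rw [← hf i]
    have : (l.get i).name ∈ l.map Passage.name := List.mem_map_of_mem (List.get_mem l i)
    rw [← hm] at this
    exact (List.mem_replicate.1 this).2
  obtain ⟨j, -, hj⟩ := hw.existsUnique_paired (f ⟨0, by omega⟩)
  have h1 := hj (f ⟨1, by omega⟩) ⟨by simp, by rw [hname, hname]⟩
  have h2 := hj (f ⟨2, by omega⟩) ⟨by simp, by rw [hname, hname]⟩
  have := f.injective (h1.trans h2.symm)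
  simp at this

/-- The tangle already uses up both occurrences that well-formedness allows. -/
theorem NamesRepeated.name_ne {k : ℕ} {S : Fin k → List Passage} (hS : NamesRepeated S)
    {π : Equiv.Perm (Fin k)} {u : Fin k → List Passage}
    (hw : WellFormed (List.ofFn fun i => S (π i) ++ u i).flatten) {i j : Fin k} {p q : Passage}
    (hp : p ∈ S i) (hq : q ∈ u j) : p.name ≠ q.name := by
  intro hpq
  have h := hw.count_name_le_two p.name
  have h1 : ((List.ofFn fun i => S (π i) ++ u i).flatten.map Passage.name).count p.name =
      ∑ i, ((S i).map Passage.name).count p.name + ∑ i, ((u i).map Passage.name).count p.name := by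
    rw [← Equiv.sum_comp π, ← Finset.sum_add_distrib, List.map_flatten, List.count_flatten,
      List.map_ofFn, List.map_ofFn, List.sum_ofFn]
    simp
  have h2 := hS i p hp
  have h3 : 0 < ((u j).map Passage.name).count p.name :=
    List.count_pos_iff.2 (hpq ▸ List.mem_map_of_mem hq)
  have h4 := Finset.single_le_sum (f := fun i => ((u i).map Passage.name).count p.name)
    (fun _ _ => Nat.zero_le _) (Finset.mem_univ j)
  omega

/-- The transferred colouring agrees with the old one outside the tangle. If it were constant, all
strands would start with colour `g`, and rigidity would make the old colouring constant too. -/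
theorem Replace.colorable {n k : ℕ} {S T : Fin k → List Passage} {D E : Diagram}
    (h : Replace S T D E) (hT : NamesRepeated T)
    (htr : TransfersTo G n S T) (hr : Rigid G S) (hD : Colorable G n D) : Colorable G n E := by
  obtain ⟨π, u, hDw, hEw⟩ := h
  obtain ⟨c, g, hg, hrun, hn⟩ := hD
  rw [hDw] at hrun hn
  have hwE := E.wellFormed
  rw [hEw] at hwE
  obtain ⟨s, t, h0, h1, hst⟩ := run_flatten_append.1 hrun
  have hpow : ∀ i, s i ^ n = 1 := by
    refine Fin.induction (by rw [h0, hg]) fun i hi => ?_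
    exact (hst i).2.pow_eq_one ((hst i).1.pow_eq_one hi)
  obtain ⟨d, hdc, hd⟩ := htr c (fun j => s (π.symm j).castSucc) (fun j => t (π.symm j))
    (fun j => hpow _) (fun j => by simpa using (hst (π.symm j)).1)
  have hu : ∀ i, ∀ p ∈ u i, d p.name = c p.name := fun i p hp =>
    hdc _ fun j q hq => hT.name_ne hwE hq hp
  have hdE : ∀ i, Run d (T (π i)) (s i.castSucc) (t i) ∧ Run d (u i) (t i) (s i.succ) :=
    fun i => ⟨by simpa using hd (π i), (run_congr (hu i)).2 (hst i).2⟩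
  refine ⟨d, g, hg, ?_, fun hm => hn ?_⟩
  · rw [hEw]
    exact run_flatten_append.2 ⟨s, t, h0, h1, hdE⟩
  · rw [hEw] at hm
    have hm' : ∀ i, Monochromatic d (T (π i)) g ∧ Monochromatic d (u i) g := by
      intro i
      constructor <;> intro p hp <;> refine hm p (List.mem_flatten.2 ⟨T (π i) ++ u i, ?_, ?_⟩)
      · exact List.mem_ofFn.2 ⟨i, rfl⟩
      · exact List.mem_append_left _ hp
      · exact List.mem_ofFn.2 ⟨i, rfl⟩
      · exact List.mem_append_right _ hp
    have ht : ∀ i : Fin k, s i.castSucc = g → t i = g := fun i hi => by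
      have h2 := (hdE i).1
      rw [hi] at h2
      exact h2.eq_of_monochromatic (hm' i).1
    have hs : ∀ i, s i = g := by
      refine Fin.induction h0 fun i hi => ?_
      have h2 := (hdE i).2
      rw [ht i hi] at h2
      exact h2.eq_of_monochromatic (hm' i).2
    have hS := hr c g (fun j => t (π.symm j)) fun j => by
      simpa [hs] using (hst (π.symm j)).1
    intro p hp hl
    obtain ⟨l, hl1, hl2⟩ := List.mem_flatten.1 hp
    obtain ⟨i, rfl⟩ := List.mem_ofFn.1 hl1
    rcases List.mem_append.1 hl2 with h2 | h2
    · exact hS _ p h2 hl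
    · rw [← hu i p h2]
      exact (hm' i).2 p h2 hl

/-! ### Names and rigidity for the moves -/

theorem forall_fin_three {P : Fin 3 → Prop} : (∀ i, P i) ↔ P 0 ∧ P 1 ∧ P 2 := by
  refine ⟨fun h => ⟨h 0, h 1, h 2⟩, fun h i => ?_⟩
  fin_cases i
  exacts [h.1, h.2.1, h.2.2]

theorem conj_zpow_eq_self_iff {g x : G} {k : ℤ} : g ^ k * x * (g ^ k)⁻¹ = g ↔ x = g := by
  rw [mul_inv_eq_iff_eq_mul, ((Commute.refl g).zpow_right k).eq, mul_right_inj]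

theorem mem_ordered {e : ℤˣ} {x y p : Passage} : p ∈ ordered e x y ↔ p = x ∨ p = y := by
  unfold ordered
  split_ifs <;> simp [or_comm]

theorem count_name_ordered (e : ℤˣ) (x y : Passage) (m : ℕ) :
    ((ordered e x y).map Passage.name).count m = [x.name, y.name].count m := by
  unfold ordered
  split_ifs
  · rfl
  · simp [List.count_cons, add_comm]

theorem namesRepeated_triangle (la lb lc : Level) (a b c : ℕ) (α β γ δ : ℤˣ) :
    NamesRepeated (triangle la lb lc a b c α β γ δ) := by
  simp only [NamesRepeated, triangle, forall_fin_three, Fin.sum_univ_three, Matrix.cons_val,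
    count_name_ordered, mem_ordered]
  refine ⟨?_, ?_, ?_⟩ <;> rintro p (rfl | rfl) <;> simp [List.count_cons] <;> omega

theorem namesRepeated_nil {k : ℕ} {S : Fin k → List Passage} (hS : ∀ i, S i = []) :
    NamesRepeated S := fun i p hp => by simp [hS] at hp

theorem WeldedMove.namesRepeated {k : ℕ} {S T : Fin k → List Passage} (h : WeldedMove S T) :
    NamesRepeated S ∧ NamesRepeated T := by
  cases h
  case R3 | VR3 | VR4 | OC => constructor <;> apply namesRepeated_triangle
  case R1 | VR1 =>
    exact ⟨namesRepeated_nil (by simp), by simp [NamesRepeated, List.count_cons]⟩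
  all_goals
    refine ⟨namesRepeated_nil (by simp [Fin.forall_fin_two]), ?_⟩
    simp [NamesRepeated, Fin.forall_fin_two, List.count_cons]
    omega

theorem VMove.namesRepeated {n k : ℕ} {S T : Fin k → List Passage} (h : VMove n S T) :
    NamesRepeated S ∧ NamesRepeated T := by
  obtain ⟨c, v, e⟩ := h
  refine ⟨by simp [NamesRepeated, Fin.forall_fin_two], fun i p hp => ?_⟩
  obtain ⟨a, ha, hpa⟩ : ∃ a < n, p.name = c a ∨ p.name = v a := by
    fin_cases i <;> simp at hp <;> obtain ⟨a, ha, rfl | rfl⟩ := hp <;> exact ⟨a, ha, by simp⟩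
  have key : ∀ f : ℕ → List Passage, p.name ∈ (f a).map Passage.name →
      0 < (((List.range n).flatMap f).map Passage.name).count p.name := fun f hf => by
    rw [List.count_pos_iff, List.map_flatMap]
    exact List.mem_flatMap.2 ⟨a, List.mem_range.2 ha, hf⟩
  have h0 := key (fun i => [⟨c i, .over, e⟩, ⟨v i, .virt, -e⟩]) (by simpa using hpa)
  have h1 := key (fun i => [⟨c i, .under, -e⟩, ⟨v i, .virt, e⟩]) (by simpa using hpa)
  simp only [Fin.sum_univ_two, Matrix.cons_val_zero, Matrix.cons_val_one]
  omega

theorem rigid_nil {k : ℕ} {S : Fin k → List Passage} (hS : ∀ i, S i = []) : Rigid G S :=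
  fun c g y _ i p hp => by simp [hS] at hp

/-- The top strand fixes the colours at `a` and `b`. Strand `1` keeps colour `g` when it passes
under the top strand, so the order of `a` and `c` on it is irrelevant. -/
theorem rigid_triangle_over (lc : Level) (hlc : lc ≠ .under) (a b c : ℕ) (α β γ δ : ℤˣ) :
    Rigid G (triangle .over .over lc a b c α β γ δ) := by
  intro f g y h
  have hab : f a = g ∧ f b = g := by
    have := h 0
    simp only [triangle, Matrix.cons_val_zero, ordered] at this
    split_ifs at this <;> simp [Run, Passage.act] at this <;> tauto
  have hc : lc ≠ .virt → f c = g := by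
    have := h 1
    simp only [triangle, Matrix.cons_val, ordered] at this
    cases lc
    · split_ifs at this <;>
        simp only [Run, Passage.act, Level.opp, hab, if_true, true_imp_iff] at this
      · exact fun _ => this.2.1.trans (conj_zpow_eq_self_iff.2 rfl)
      · exact fun _ => this.1
    · simp at hlc
    · simp
  have hc' : lc.opp ≠ .virt → f c = g := fun h' => hc (by rintro rfl; simp [Level.opp] at h')
  simp only [triangle, forall_fin_three, Matrix.cons_val, Monochromatic, mem_ordered]
  refine ⟨?_, ?_, ?_⟩ <;> rintro p (rfl | rfl) <;> simp [hab] <;> assumption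

theorem rigid_triangle_virt (lc : Level) (hlc : lc ≠ .under) (a b c : ℕ) (α β γ δ : ℤˣ) :
    Rigid G (triangle .virt .virt lc a b c α β γ δ) := by
  intro f g y h
  have hc : lc ≠ .virt → f c = g := by
    have := h 1
    simp only [triangle, Matrix.cons_val, ordered] at this
    cases lc
    · split_ifs at this <;> simp [Run, Passage.act, Level.opp] at this <;> simp [this]
    · simp at hlc
    · simp
  have hc' : lc.opp ≠ .virt → f c = g := fun h' => hc (by rintro rfl; simp [Level.opp] at h')
  simp only [triangle, forall_fin_three, Matrix.cons_val, Monochromatic, mem_ordered]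
  refine ⟨?_, ?_, ?_⟩ <;> rintro p (rfl | rfl) <;> simp [Level.opp] <;> assumption

theorem run_kink {c : ℕ → G} {a : ℕ} {l : Level} (hl : l ≠ .virt) {e : ℤˣ} {x y : G} :
    Run c [⟨a, l, e⟩, ⟨a, l.opp, -e⟩] x y ↔ c a = x ∧ x = y := by
  cases l
  · simp only [Run, Passage.act, Level.opp, if_true, true_imp_iff, reduceCtorEq, if_false,
      false_imp_iff, true_and, and_congr_right_iff]
    rintro rfl
    rw [conj_zpow_eq_self_iff.2 rfl]
  · simp only [Run, Passage.act, Level.opp, if_true, true_imp_iff, reduceCtorEq, if_false,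
      false_imp_iff, true_and]
    rw [eq_comm, conj_zpow_eq_self_iff, eq_comm, and_congr_right_iff]
    rintro rfl
    rw [conj_zpow_eq_self_iff.2 rfl]
  · exact absurd rfl hl

theorem WeldedMove.rigid {k : ℕ} {S T : Fin k → List Passage} (h : WeldedMove S T) :
    Rigid G S ∧ Rigid G T := by
  cases h
  case R3 | OC =>
    constructor <;> apply rigid_triangle_over <;> simp
  case VR3 | VR4 =>
    constructor <;> apply rigid_triangle_virt <;> simp
  case R1 a l hl e =>
    refine ⟨rigid_nil (by simp), fun c g y h => ?_⟩
    have hc : c a = g := ((run_kink hl).1 (h 0)).1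
    simp [Monochromatic, hc]
  case VR1 =>
    exact ⟨rigid_nil (by simp), fun c g y h => by simp [Monochromatic]⟩
  all_goals
    refine ⟨rigid_nil (by simp [Fin.forall_fin_two]), fun c g y h => ?_⟩
    simp [Run, Passage.act, Monochromatic, Fin.forall_fin_two] at h ⊢
    try tauto

/-! ### Transfer of colourings across the welded moves -/

/-- The Reidemeister move III changes at most the colour of the middle strand at its crossing with
the bottom strand. -/
theorem transfersTo_triangle_over (n : ℕ) (a b c : ℕ) (α β γ δ : ℤˣ) :
    TransfersTo G n (triangle .over .over .over a b c α β γ δ)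
      (triangle .over .over .over a b c α β γ (-δ)) := by
  intro f x y _ h
  simp only [triangle, forall_fin_three, Matrix.cons_val] at h
  have hab : f a = x 0 ∧ f b = x 0 := by
    have := h.1
    unfold ordered at this
    split_ifs at this <;> simp [Run, Passage.act] at this <;> tauto
  -- Strand `1` is conjugated by `X` under the top strand; it meets `c` after this iff `δ * β = 1`.
  -- The move reverses the order, which gives the new colour `v` at `c`.
  set X := x 0 ^ ((-α : ℤˣ) : ℤ) with hX
  have hc : f c = if δ * β = 1 then X * x 1 * X⁻¹ else x 1 := by
    have := h.2.1
    unfold ordered at this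
    split_ifs at this ⊢ <;>
      simp only [Run, Passage.act, Level.opp, hab, if_true, true_imp_iff] at this
    · exact this.2.1
    · exact this.1
  set v := if δ * β = 1 then x 1 else X * x 1 * X⁻¹ with hv
  -- The names `a`, `b`, `c` are not assumed distinct; this keeps the update at `c` from spoiling
  -- the colours at `a` and `b`.
  have hcv : f c = x 0 → v = x 0 := by
    rw [hc, hv]
    split_ifs
    · exact conj_zpow_eq_self_iff.1
    · exact conj_zpow_eq_self_iff.2
  obtain ⟨d, hd, hdc⟩ : ∃ d : ℕ → G, (∀ m, m ≠ c → d m = f m) ∧ d c = v :=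
    ⟨Function.update f c v, fun m hm => Function.update_of_ne hm _ _, Function.update_self ..⟩
  have hdab : ∀ m, f m = x 0 → d m = x 0 := fun m hm => by
    by_cases h : m = c
    · rw [h, hdc, hcv (h ▸ hm)]
    · rw [hd m h, hm]
  have hda := hdab a hab.1
  have hdb := hdab b hab.2
  refine ⟨d, fun m hm => hd m fun hmc => hm 1 ⟨c, .over, γ⟩ ?_ hmc.symm, ?_⟩
  · simp [triangle, mem_ordered]
  simp only [triangle, forall_fin_three, Matrix.cons_val]
  clear hd hcv hdab
  rcases Int.units_eq_one_or α with rfl | rfl <;> rcases Int.units_eq_one_or β with rfl | rfl <;>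
  rcases Int.units_eq_one_or δ with rfl | rfl <;> rcases Int.units_eq_one_or γ with rfl | rfl <;>
  simp [Run, ordered, Passage.act, Level.opp, hab, hc, hda, hdb, hdc, hX, hv, mul_assoc] at h ⊢ <;>
  exact h

theorem run_ordered_of_virt {c : ℕ → G} {e : ℤˣ} {p q : Passage}
    (h : p.level = .virt ∨ q.level = .virt) {x y : G} :
    Run c (ordered e p q) x y ↔ Run c [p, q] x y := by
  unfold ordered
  split_ifs
  · rfl
  · rcases h with h | h <;> simp [Run, Passage.act, h]

theorem run_ordered_of_over {c : ℕ → G} {e : ℤˣ} {p q : Passage}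
    (hp : p.level = .over) (hq : q.level = .over) {x y : G} :
    Run c (ordered e p q) x y ↔ Run c [p, q] x y := by
  unfold ordered
  split_ifs
  · rfl
  · simp [Run, Passage.act, hp, hq]
    tauto

theorem TransfersTo.of_run_iff {n k : ℕ} {S T : Fin k → List Passage}
    (h : ∀ (c : ℕ → G) i x y, Run c (S i) x y ↔ Run c (T i) x y) :
    TransfersTo G n S T ∧ TransfersTo G n T S :=
  ⟨fun c _ _ _ hr => ⟨c, fun _ _ => rfl, fun i => (h c i _ _).1 (hr i)⟩,
    fun c _ _ _ hr => ⟨c, fun _ _ => rfl, fun i => (h c i _ _).2 (hr i)⟩⟩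

theorem transfersTo_R1 (n a : ℕ) {l : Level} (hl : l ≠ .virt) (e : ℤˣ) :
    TransfersTo G n ![[]] ![[⟨a, l, e⟩, ⟨a, l.opp, -e⟩]] ∧
      TransfersTo G n ![[⟨a, l, e⟩, ⟨a, l.opp, -e⟩]] ![[]] := by
  constructor <;> intro c x y _ h
  · refine ⟨Function.update c a (x 0), fun m hm => Function.update_of_ne ?_ _ _, ?_⟩
    · rintro rfl
      exact hm 0 _ List.mem_cons_self rfl
    · rw [Fin.forall_fin_one] at h ⊢
      exact (run_kink hl).2 ⟨Function.update_self .., h⟩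
  · rw [Fin.forall_fin_one] at h
    exact ⟨c, fun _ _ => rfl, Fin.forall_fin_one.2 ((run_kink hl).1 h).2⟩

/-- The two under-passages conjugate by inverse powers of the same over-colour and cancel in either
order, which covers both orientations. -/
theorem transfersTo_R2 (n a b : ℕ) (e : ℤˣ) {w : List Passage}
    (hw : w = [⟨a, .under, -e⟩, ⟨b, .under, e⟩] ∨ w = [⟨b, .under, e⟩, ⟨a, .under, -e⟩]) :
    TransfersTo G n ![[], []] ![[⟨a, .over, e⟩, ⟨b, .over, -e⟩], w] ∧
      TransfersTo G n ![[⟨a, .over, e⟩, ⟨b, .over, -e⟩], w] ![[], []] := by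
  have hover : ∀ (c : ℕ → G) x y, Run c [⟨a, .over, e⟩, ⟨b, .over, -e⟩] x y ↔
      (c a = x ∧ c b = x) ∧ x = y := fun c x y => by simp [Run, Passage.act, and_assoc]
  have hunder : ∀ (c : ℕ → G), c a = c b → ∀ x y, Run c w x y ↔ x = y := by
    intro c hc x y
    rcases hw with rfl | rfl <;> simp [Run, Passage.act, hc, mul_assoc]
  constructor <;> intro c x y _ h <;> rw [Fin.forall_fin_two] at h
  · refine ⟨fun m => if m = a ∨ m = b then x 0 else c m, fun m hm => if_neg ?_, ?_⟩
    · rintro (rfl | rfl)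
      · exact hm 0 _ List.mem_cons_self rfl
      · exact hm 0 _ (List.mem_cons_of_mem _ List.mem_cons_self) rfl
    · exact Fin.forall_fin_two.2 ⟨(hover _ _ _).2 ⟨by simp, h.1⟩, (hunder _ (by simp) _ _).2 h.2⟩
  · obtain ⟨⟨ha, hb⟩, h0⟩ := (hover _ _ _).1 h.1
    exact ⟨c, fun _ _ => rfl,
      Fin.forall_fin_two.2 ⟨h0, (hunder _ (ha.trans hb.symm) _ _).1 h.2⟩⟩

theorem WeldedMove.transfersTo {n k : ℕ} {S T : Fin k → List Passage} (h : WeldedMove S T) :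
    TransfersTo G n S T ∧ TransfersTo G n T S := by
  cases h
  case R1 a l hl e => exact transfersTo_R1 _ _ hl _
  case R2_parallel => exact transfersTo_R2 _ _ _ _ (.inl rfl)
  case R2_antiparallel => exact transfersTo_R2 _ _ _ _ (.inr rfl)
  case R3 =>
    refine ⟨by apply transfersTo_triangle_over, ?_⟩
    simpa using transfersTo_triangle_over n _ _ _ _ _ _ (-1)
  case VR3 | VR4 | OC =>
    refine TransfersTo.of_run_iff fun f => forall_fin_three.2 ⟨fun x y => ?_, fun x y => ?_, fun x y => ?_⟩ <;>
      simp [triangle, run_ordered_of_virt, run_ordered_of_over, Level.opp]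
  case VR1 => exact TransfersTo.of_run_iff fun c i x y => by fin_cases i; simp [Run, Passage.act]
  all_goals exact TransfersTo.of_run_iff fun c i x y => by fin_cases i <;> simp [Run, Passage.act]

/-! ### The `V^n`-move -/

theorem run_over_flatMap {c : ℕ → G} {a v : ℕ → ℕ} {e : ℤˣ} {l : List ℕ} {x y : G} :
    Run c (l.flatMap fun i => [⟨a i, .over, e⟩, ⟨v i, .virt, -e⟩]) x y ↔
      x = y ∧ ∀ i ∈ l, c (a i) = x := by
  induction l with
  | nil => simp [Run]
  | cons i l ih =>
    simp only [List.flatMap_cons, List.cons_append, List.nil_append, Run, Passage.act]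
    simp [ih]
    tauto

theorem run_under_flatMap {c : ℕ → G} {a v : ℕ → ℕ} {e : ℤˣ} {l : List ℕ} {g x y : G}
    (h : ∀ i ∈ l, c (a i) = g) :
    Run c (l.flatMap fun i => [⟨a i, .under, -e⟩, ⟨v i, .virt, e⟩]) x y ↔
      (g ^ ((-e : ℤˣ) : ℤ)) ^ l.length * x * ((g ^ ((-e : ℤˣ) : ℤ)) ^ l.length)⁻¹ = y := by
  induction l generalizing x with
  | nil => simp [Run]
  | cons i l ih =>
    simp only [List.mem_cons, forall_eq_or_imp] at h
    simp only [List.flatMap_cons, List.cons_append, List.nil_append, Run, Passage.act]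
    simp only [reduceCtorEq, if_true, if_false, false_imp_iff, true_and, ih h.2, h.1,
      List.length_cons, pow_succ, mul_inv_rev, mul_assoc]

theorem VMove.rigid {n k : ℕ} {S T : Fin k → List Passage} (h : VMove n S T) :
    Rigid G S ∧ Rigid G T := by
  obtain ⟨a, v, e⟩ := h
  refine ⟨fun c g y _ => by simp [Fin.forall_fin_two, Monochromatic], fun c g y h => ?_⟩
  have := (run_over_flatMap.1 (h 0)).2
  simp only [List.mem_range] at this
  rw [Fin.forall_fin_two]
  constructor <;> intro p hp hl <;> simp at hp <;> obtain ⟨i, hi, rfl | rfl⟩ := hp <;>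
    first | exact this i hi | simp at hl

theorem VMove.transfersTo {n k : ℕ} {S T : Fin k → List Passage} (h : VMove n S T) :
    TransfersTo G n S T ∧ TransfersTo G n T S := by
  classical
  obtain ⟨a, v, e⟩ := h
  have hz : ∀ g : G, g ^ n = 1 → (g ^ ((-e : ℤˣ) : ℤ)) ^ n = 1 := fun g hg => by
    rw [← zpow_natCast, zpow_comm, zpow_natCast, hg, one_zpow]
  constructor <;> intro c x y hx h
  · rw [Fin.forall_fin_two] at h
    -- All new classical crossings get the colour of strand `0`, their over-strand.
    refine ⟨fun b => if ∃ i < n, a i = b then x 0 else c b, fun b hb => ?_, ?_⟩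
    · refine if_neg fun ⟨i, hi, hib⟩ => hb 0 ⟨a i, .over, e⟩ ?_ hib
      simp only [Matrix.cons_val_zero, List.mem_flatMap, List.mem_range]
      exact ⟨i, hi, by simp⟩
    · have hd : ∀ i ∈ List.range n, (if ∃ j < n, a j = a i then x 0 else c (a i)) = x 0 :=
        fun i hi => if_pos ⟨i, List.mem_range.1 hi, rfl⟩
      refine Fin.forall_fin_two.2 ⟨run_over_flatMap.2 ⟨h.1, hd⟩, (run_under_flatMap hd).2 ?_⟩
      rw [List.length_range, hz _ (hx 0)]
      simpa [Run] using h.2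
  · rw [Fin.forall_fin_two] at h
    obtain ⟨h0, h1⟩ := run_over_flatMap.1 h.1
    have h2 := (run_under_flatMap h1).1 h.2
    rw [List.length_range, hz _ (hx 0)] at h2
    exact ⟨c, fun _ _ => rfl, Fin.forall_fin_two.2 ⟨h0, by simpa [Run] using h2⟩⟩

/-! ### Invariance, the unknot and the trefoil -/

theorem Replace.symm {k : ℕ} {S T : Fin k → List Passage} {D E : Diagram} (h : Replace S T D E) :
    Replace T S E D := by
  obtain ⟨π, u, hD, hE⟩ := h
  exact ⟨π, u, hE, hD⟩

theorem colorable_iff_of_eqvGen {n : ℕ} {D E : Diagram}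
    (h : Relation.EqvGen (fun D E => WeldedStep D E ∨ VStep n D E) D E) :
    Colorable G n D ↔ Colorable G n E := by
  induction h with
  | rel D E h =>
    rcases h with (h | ⟨k, S, T, hm, h⟩) | ⟨k, S, T, hm, h⟩
    · exact h.colorable
    · exact ⟨h.colorable hm.namesRepeated.2 hm.transfersTo.1 hm.rigid.1,
        h.symm.colorable hm.namesRepeated.1 hm.transfersTo.2 hm.rigid.2⟩
    · exact ⟨h.colorable hm.namesRepeated.2 hm.transfersTo.1 hm.rigid.1,
        h.symm.colorable hm.namesRepeated.1 hm.transfersTo.2 hm.rigid.2⟩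
  | refl D => rfl
  | symm D E _ ih => exact ih.symm
  | trans D E F _ _ ih1 ih2 => exact ih1.trans ih2

theorem colorable_iff_of_knot_eq {n : ℕ} {D E : Diagram} (h : D.knot = E.knot) :
    Colorable G n D ↔ Colorable G n E :=
  colorable_iff_of_eqvGen ((Quotient.exact h).mono fun _ _ => Or.inl)

theorem not_colorable_unknotDiagram {n : ℕ} : ¬ Colorable G n unknotDiagram := by
  rintro ⟨c, g, -, -, h⟩
  exact h fun p hp => by simp [unknotDiagram] at hp

theorem colorable_trefoilDiagram {n : ℕ} {a b : G} (ha : a ^ n = 1) (hab : a ≠ b)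
    (h : a * b * a = b * a * b) (e : ℤˣ) : Colorable G n (trefoilDiagram e) := by
  -- The arc over crossing `0` starts with `a`; passing under crossing `1`, of colour `b`, forces
  -- the colour at crossing `2`. The braid relation makes the two remaining under-passages return
  -- `b` and then `a`.
  refine ⟨fun i => if i = 0 then a else if i = 1 then b else
    b ^ ((-e : ℤˣ) : ℤ) * a * (b ^ ((-e : ℤˣ) : ℤ))⁻¹, a, ha, ?_, fun hm => ?_⟩
  · have h1 : b⁻¹ * (a * b) = a * (b * a⁻¹) := by
      rw [inv_mul_eq_iff_eq_mul, ← mul_assoc, ← mul_assoc, eq_mul_inv_iff_mul_eq, h]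
    have h2 : b * (a * b⁻¹) = a⁻¹ * (b * a) := by
      rw [eq_inv_mul_iff_mul_eq, ← mul_assoc, ← mul_assoc, mul_inv_eq_iff_eq_mul, h]
    have h3 : ∀ x, b * (a * (b * x)) = a * (b * (a * x)) := fun x => by
      simp only [← mul_assoc, h]
    rcases Int.units_eq_one_or e with rfl | rfl <;>
      simp [trefoilDiagram, trefoilWord, Run, Passage.act, mul_assoc, h1, h2, h3]
  · exact hab (hm ⟨1, .under, -e⟩ (by simp [trefoilDiagram, trefoilWord]) (by simp)).symm

/-- The generators of the braid group on three strands in the reduced Burau representation at an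
`n`-th root of unity have order `n`. -/
theorem exists_braid_relation_pow_eq_one {n : ℕ} (hn : 2 ≤ n) :
    ∃ a b : GL (Fin 2) ℂ, a ^ n = 1 ∧ a ≠ b ∧ a * b * a = b * a * b := by
  have hz := Complex.isPrimitiveRoot_exp n (by omega)
  set z := Complex.exp (2 * Real.pi * Complex.I / n)
  have hz0 : z ≠ 0 := Complex.exp_ne_zero _
  refine ⟨Matrix.GeneralLinearGroup.mkOfDetNeZero !![z, 1; 0, 1] (by simpa),
    Matrix.GeneralLinearGroup.mkOfDetNeZero !![1, 0; -z, z] (by simpa), ?_, ?_, ?_⟩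
  · have hk : ∀ k : ℕ, (!![z, 1; 0, 1] : Matrix (Fin 2) (Fin 2) ℂ) ^ k =
        !![z ^ k, ∑ i ∈ Finset.range k, z ^ i; 0, 1] := by
      intro k
      induction k with
      | zero => simp [Matrix.one_fin_two]
      | succ k ih =>
        rw [pow_succ, ih, Finset.sum_range_succ, Matrix.mul_fin_two]
        simp [pow_succ, add_comm]
    refine Units.ext ?_
    rw [Units.val_pow_eq_pow_val]
    refine (hk n).trans ?_
    rw [hz.pow_eq_one, hz.geom_sum_eq_zero (by omega)]
    simp [Matrix.one_fin_two]
  · intro h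
    have := congrArg (fun M : GL (Fin 2) ℂ => (M : Matrix (Fin 2) (Fin 2) ℂ) 0 1) h
    change (1 : ℂ) = 0 at this
    exact one_ne_zero this
  · refine Units.ext ?_
    change (!![z, 1; 0, 1] * !![1, 0; -z, z] * !![z, 1; 0, 1] : Matrix (Fin 2) (Fin 2) ℂ) =
      !![1, 0; -z, z] * !![z, 1; 0, 1] * !![1, 0; -z, z]
    simp

theorem not_vEquivalent_trefoil_unknot {n : ℕ} (hn : 2 ≤ n) (e : ℤˣ) :
    ¬ VEquivalent n (trefoil e) unknot := by
  rintro ⟨D, E, hD, hE, h⟩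
  obtain ⟨a, b, ha, hab, hr⟩ := exists_braid_relation_pow_eq_one hn
  exact not_colorable_unknotDiagram ((colorable_iff_of_knot_eq hE).1
    ((colorable_iff_of_eqvGen h).1 ((colorable_iff_of_knot_eq hD).2
      (colorable_trefoilDiagram ha hab hr e))))

end Coloring

end Welded

/-- For `n ≥ 2` neither trefoil is `V^n`-equivalent to the unknot; hence the `V^n`-move is not an
unknotting operation on welded knots. -/
theorem proposition5p2 (n : ℕ) (hn : 2 ≤ n) :
    (∀ e : ℤˣ, ¬ Welded.VEquivalent n (Welded.trefoil e) Welded.unknot) ∧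
      ¬ Welded.VUnknotting n :=
  ⟨Welded.not_vEquivalent_trefoil_unknot hn, fun h =>
    Welded.not_vEquivalent_trefoil_unknot hn 1 (h _)⟩
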